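/- Let $\mathbf{x},\mathbf{y}$ be two letters. For a word $\mathbf{w}=\mathbf{w}_1\cdots\mathbf{w}_{n-1}$ in these letters (an $\mathbf{xy}$-word, possibly empty), the descent polytope $\mathrm{DP}_{\mathbf{w}}\subseteq\mathbb{R}^n$ is the set of all $(x_1,\dots,x_n)\in[0,1]^n$ such that, for $1\le i\le n-1$, $x_i\le x_{i+1}$ if $\mathbf{w}_i=\mathbf{x}$ and $x_i\ge x_{i+1}$ if $\mathbf{w}_i=\mathbf{y}$. Its $f$-polynomial is $F_{\mathbf{w}}(t)=\sum_{i=0}^{n} f_i\,t^i$, where $f_i$ is the (finite) number of $i$-dimensional nonempty faces of $\mathrm{DP}_{\mathbf{w}}$, the polytope itself being counted as a face. For an $\mathbf{xy}$-word $\mathbf{v}$, let $\overline{\mathbf{v}}$ be the word obtained from $\mathbf{v}$ by exchanging $\mathbf{x}$ and $\mathbf{y}$. **Theorem.** Let $\mathbf{u}$ and $\mathbf{v}$ be $\mathbf{xy}$-words with $|\mathbf{u}|+|\mathbf{v}|=n-3$, where $|\cdot|$ denotes length. Then the difference $$F_{\mathbf{u}\mathbf{y}\mathbf{x}\mathbf{v}}(t)-F_{\mathbf{u}\mathbf{y}\mathbf{y}\overline{\mathbf{v}}}(t)$$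 has strictly positive coefficients at $1,t,\dots,t^{n-1}$. That is, for every $0\le i\le n-1$ the polytope $\mathrm{DP}_{\mathbf{u}\mathbf{y}\mathbf{x}\mathbf{v}}$ has strictly more $i$-dimensional faces than $\mathrm{DP}_{\mathbf{u}\mathbf{y}\mathbf{y}\overline{\mathbf{v}}}$. -/

import Mathlib

/-- The two letters of the alphabet. -/
inductive XYLetter : Type
  | x
  | y

/-- The involution exchanging the letters `x` and `y`. -/
def XYLetter.swap : XYLetter → XYLetter
  | .x => .y
  | .y => .x

/-- An xy-word: a finite (possibly empty) word in the letters `x` and `y`. -/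
abbrev XYWord : Type := List XYLetter

/-- The word obtained from `w` by replacing every `x` by `y` and vice versa. -/
def XYWord.bar (w : XYWord) : XYWord := w.map XYLetter.swap

/-- The descent polytope of an xy-word `w` of length `n - 1`: all `p = (p₁, …, pₙ)` in the cube
`[0,1]ⁿ` such that `pᵢ ≤ pᵢ₊₁` if the `i`-th letter of `w` is `x` and `pᵢ ≥ pᵢ₊₁` if it is `y`. -/
def descentPolytope (w : XYWord) : Set (Fin (w.length + 1) → ℝ) :=
  {p | (∀ i, 0 ≤ p i ∧ p i ≤ 1) ∧
    ∀ i : Fin w.length,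
      (w.get i = XYLetter.x → p i.castSucc ≤ p i.succ) ∧
      (w.get i = XYLetter.y → p i.castSucc ≥ p i.succ)}

/-- The nonempty faces of `P ⊆ ℝⁿ`: the nonempty subsets on which some linear functional attains
its maximum over `P`. The zero functional gives `P` itself. -/
def nonemptyFaces {n : ℕ} (P : Set (Fin n → ℝ)) : Set (Set (Fin n → ℝ)) :=
  {F | F.Nonempty ∧ IsExposed ℝ P F}

/-- The (affine) dimension of a nonempty subset of `ℝⁿ`. -/
noncomputable def affDim {n : ℕ} (F : Set (Fin n → ℝ)) : ℕ :=
  Module.finrank ℝ (vectorSpan ℝ F)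

/-- `fNumber P i` is the number of `i`-dimensional faces of the polytope `P`. -/
noncomputable def fNumber {n : ℕ} (P : Set (Fin n → ℝ)) (i : ℕ) : ℕ :=
  {F ∈ nonemptyFaces P | affDim F = i}.ncard

/-- The f-polynomial `∑ᵢ fᵢ(P) tⁱ` of a polytope `P ⊆ ℝⁿ`; the sum runs over the dimensions
`0, …, n` of the nonempty faces, `P` itself included. -/
noncomputable def fPolynomial {n : ℕ} (P : Set (Fin n → ℝ)) : Polynomial ℤ :=
  ∑ i ∈ Finset.range (n + 1), Polynomial.C (fNumber P i : ℤ) * Polynomial.X ^ i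

/-- The f-polynomial of the descent polytope of the word `w`. -/
noncomputable def descentFPolynomial (w : XYWord) : Polynomial ℤ :=
  fPolynomial (descentPolytope w)

/-!
A face of the descent polytope is determined by the set of defining inequalities that are tight at
its relative interior points, and it can be recorded by one token per coordinate: the value is `0`,
or `1`, or strictly between; in the last case it is either equal to the preceding coordinate
(`join`) or not (`fresh`). A sequence of tokens comes from a face exactly when consecutive tokens
are compatible with the letter between them, and the dimension of the face is the number of `fresh`
tokens. Hence the `f`-polynomial is computed by a transfer operator on polynomial-valued functions
of tokens (`fNumber_descentPolytope`). The geometric input is that the nonempty exposed faces of a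
polyhedron correspond to the sets of tight constraints that occur (`nonemptyFaces_polyhedron`,
`faceThrough_eq_iff`), and that the direction space of a face is the common kernel of its tight
constraints (`mem_vectorSpan_faceThrough`).

For the comparison, let `p` and `q` be the generating functions of the completions along `v` of a
coordinate equal to `0`, respectively strictly between `0` and `1`. Exchanging the letters
corresponds to exchanging the values `0` and `1`. A direct computation with the operators of the
letters `x` and `y` then shows that the `f`-polynomials for `u y x v` and for `u y y` followed by
the flipped `v` differ by `(p + t q) * g`, where `g` counts the sequences along `u` that do not end
at `1` (`transferWord_yx_eq`). The all-zero sequence contributes the constant term, and the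
sequences of interior values alone contribute `t (1 + t) ^ |v|` to the first factor and
`t (1 + t) ^ |u|` to the second. So the coefficients of the factors are positive up to degrees
`|v| + 1` and `|u| + 1`, and those of the product up to degree `|u| + |v| + 2 = n - 1`.
-/

/-! ### Faces of polyhedra and active constraints -/

section Polyhedron

open Filter Topology

variable {E J : Type*} [NormedAddCommGroup E] [NormedSpace ℝ E]

/-- The solution set of the linear inequalities `l j x ≤ b j`. -/
def polyhedron (l : J → StrongDual ℝ E) (b : J → ℝ) : Set E := {x | ∀ j, l j x ≤ b j}

/-- The indices of the inequalities `l j x ≤ b j` that are tight at `x`. -/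
def activeSet (l : J → StrongDual ℝ E) (b : J → ℝ) (x : E) : Set J := {j | l j x = b j}

/-- The smallest face of the polyhedron that contains its point `x`: all constraints tight at `x`
are tight there. -/
def faceThrough (l : J → StrongDual ℝ E) (b : J → ℝ) (x : E) : Set E :=
  {y ∈ polyhedron l b | activeSet l b x ⊆ activeSet l b y}

variable {l : J → StrongDual ℝ E} {b : J → ℝ} {x y : E}

theorem self_mem_faceThrough (hx : x ∈ polyhedron l b) : x ∈ faceThrough l b x :=
  ⟨hx, subset_rfl⟩

theorem faceThrough_eq_iff (hx : x ∈ polyhedron l b) (hy : y ∈ polyhedron l b) :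
    faceThrough l b x = faceThrough l b y ↔ activeSet l b x = activeSet l b y := by
  refine ⟨fun h => ?_, fun h => by simp only [faceThrough, h]⟩
  have h1 : y ∈ faceThrough l b x := h ▸ self_mem_faceThrough hy
  have h2 : x ∈ faceThrough l b y := h ▸ self_mem_faceThrough hx
  exact h1.2.antisymm h2.2

/-- From a point of the polyhedron one can move a little in any direction along which the tight
constraints are constant, without leaving the smallest face through the point. -/
theorem exists_pos_add_smul_mem_faceThrough [Finite J] (hx : x ∈ polyhedron l b) {v : E}
    (hv : ∀ j ∈ activeSet l b x, l j v = 0) :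
    ∃ ε : ℝ, 0 < ε ∧ x + ε • v ∈ faceThrough l b x := by
  have key : ∀ᶠ ε : ℝ in 𝓝[>] 0, ∀ j, l j x + ε * l j v ≤ b j := by
    refine eventually_all.2 fun j => ?_
    by_cases hj : j ∈ activeSet l b x
    · exact Eventually.of_forall fun ε => by rw [hv j hj, mul_zero, add_zero]; exact hx j
    · have hlt : l j x < b j := lt_of_le_of_ne (hx j) hj
      have hc : Tendsto (fun ε : ℝ => l j x + ε * l j v) (𝓝 0) (𝓝 (l j x + 0 * l j v)) :=
        Continuous.tendsto (by fun_prop) 0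
      rw [zero_mul, add_zero] at hc
      exact ((hc.eventually_lt_const hlt).filter_mono nhdsWithin_le_nhds).mono fun _ h => h.le
  obtain ⟨ε, h, hε⟩ := (key.and self_mem_nhdsWithin).exists
  refine ⟨ε, hε, fun j => by simpa using h j, fun j hj => ?_⟩
  have hj' : l j x = b j := hj
  simp [activeSet, hv j hj, hj']

theorem isExposed_faceThrough [Finite J] (hx : x ∈ polyhedron l b) :
    IsExposed ℝ (polyhedron l b) (faceThrough l b x) := by
  classical
  cases nonempty_fintype J
  intro _
  -- The functional is the sum of the constraints that are tight at `x`.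
  let s : Finset J := Finset.univ.filter (· ∈ activeSet l b x)
  have hs : ∀ j, j ∈ s ↔ l j x = b j := fun j =>
    Finset.mem_filter_univ (p := (· ∈ activeSet l b x)) j
  have hle : ∀ y ∈ polyhedron l b, (∑ j ∈ s, l j) y ≤ (∑ j ∈ s, l j) x := fun y hy => by
    simp only [sum_apply]
    exact Finset.sum_le_sum fun j hj => ((hs j).1 hj).symm ▸ hy j
  refine ⟨∑ j ∈ s, l j, Set.ext fun y => ⟨fun hy => ⟨hy.1, fun z hz => ?_⟩, fun hy => ⟨hy.1, ?_⟩⟩⟩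
  · refine (hle z hz).trans (le_of_eq ?_)
    simp only [sum_apply]
    refine Finset.sum_congr rfl fun j hj => ?_
    have : l j y = b j := hy.2 ((hs j).1 hj)
    rw [this, (hs j).1 hj]
  · have heq := le_antisymm (hle y hy.1) (hy.2 x hx)
    simp only [sum_apply] at heq
    rw [Finset.sum_eq_sum_iff_of_le fun j hj => ((hs j).1 hj).symm ▸ hy.1 j] at heq
    intro j hj
    exact (heq j ((hs j).2 hj)).trans hj

/-- A nonempty exposed face is the smallest face through any of its points that has as few tight
constraints as possible. -/
theorem IsExposed.exists_eq_faceThrough [Finite J] {F : Set E}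
    (hF : IsExposed ℝ (polyhedron l b) F) (hne : F.Nonempty) :
    ∃ x ∈ polyhedron l b, F = faceThrough l b x := by
  obtain ⟨f, hf⟩ := hF hne
  obtain ⟨x, hxF, hmin⟩ :=
    exists_minimalFor_of_wellFoundedLT (· ∈ F) (fun x => (activeSet l b x).ncard) hne
  have hFP : ∀ y ∈ F, y ∈ polyhedron l b := fun y hy => (hf ▸ hy : y ∈ {y ∈ _ | _}).1
  have hmax : ∀ y ∈ F, ∀ z ∈ polyhedron l b, f z ≤ f y := fun y hy =>
    (hf ▸ hy : y ∈ {y ∈ _ | _}).2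
  have hx := hFP x hxF
  refine ⟨x, hx, Set.Subset.antisymm (fun y hy => ⟨hFP y hy, ?_⟩) fun y hy => ?_⟩
  · -- The midpoint of `x` and `y` lies in `F`, and only common tight constraints are tight there.
    have hyP := hFP y hy
    set m : E := (2⁻¹ : ℝ) • x + (2⁻¹ : ℝ) • y with hm
    have hlm : ∀ g : StrongDual ℝ E, g m = 2⁻¹ * g x + 2⁻¹ * g y := fun g => by simp [hm]
    have hmP : m ∈ polyhedron l b := fun j => by
      rw [hlm]; linarith [hx j, hyP j]
    have hmF : m ∈ F := by
      rw [hf]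
      refine ⟨hmP, fun z hz => ?_⟩
      rw [hlm]
      linarith [hmax x hxF z hz, hmax y hy z hz]
    have hact : ∀ j ∈ activeSet l b m, l j x = b j ∧ l j y = b j := fun j hj => by
      have h1 : l j m = b j := hj
      rw [hlm] at h1
      constructor <;> linarith [hx j, hyP j]
    have hsub : activeSet l b m ⊆ activeSet l b x := fun j hj => (hact j hj).1
    have heq : activeSet l b m = activeSet l b x :=
      Set.eq_of_subset_of_ncard_le hsub (hmin hmF (Set.ncard_le_ncard hsub))
    exact fun j hj => (hact j (heq ▸ hj)).2
  · -- Moving from `x` away from `y` stays in the polyhedron, so `f` cannot drop from `x` to `y`.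
    obtain ⟨ε, hε, hmem⟩ := exists_pos_add_smul_mem_faceThrough hx (v := x - y) fun j hj => by
      have h1 : l j x = b j := hj
      have h2 : l j y = b j := hy.2 hj
      rw [map_sub, h1, h2, sub_self]
    have h := hmax x hxF _ hmem.1
    simp only [map_add, map_smul, map_sub, smul_eq_mul] at h
    have hxy : f x ≤ f y := by nlinarith
    rw [hf]
    exact ⟨hy.1, fun z hz => (hmax x hxF z hz).trans hxy⟩

theorem mem_vectorSpan_faceThrough [Finite J] (hx : x ∈ polyhedron l b) (v : E) :
    v ∈ vectorSpan ℝ (faceThrough l b x) ↔ ∀ j ∈ activeSet l b x, l j v = 0 := by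
  constructor
  · intro hv j hj
    have hle : vectorSpan ℝ (faceThrough l b x) ≤ LinearMap.ker (l j : E →ₗ[ℝ] ℝ) := by
      rw [vectorSpan, Submodule.span_le]
      rintro _ ⟨y, hy, z, hz, rfl⟩
      have h1 : l j y = b j := hy.2 hj
      have h2 : l j z = b j := hz.2 hj
      simp [h1, h2]
    simpa using hle hv
  · intro hv
    obtain ⟨ε, hε, hmem⟩ := exists_pos_add_smul_mem_faceThrough hx hv
    have h := vsub_mem_vectorSpan ℝ hmem (self_mem_faceThrough hx)
    rw [vsub_eq_sub, add_sub_cancel_left] at h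
    exact (Submodule.smul_mem_iff _ hε.ne').1 h

end Polyhedron

section Polytope

variable {n : ℕ} {J : Type*} [Finite J] (l : J → StrongDual ℝ (Fin n → ℝ)) (b : J → ℝ)

theorem nonemptyFaces_polyhedron :
    nonemptyFaces (polyhedron l b) = faceThrough l b '' polyhedron l b := by
  ext F
  constructor
  · rintro ⟨hne, hF⟩
    obtain ⟨x, hx, rfl⟩ := hF.exists_eq_faceThrough hne
    exact ⟨x, hx, rfl⟩
  · rintro ⟨x, hx, rfl⟩
    exact ⟨⟨x, self_mem_faceThrough hx⟩, isExposed_faceThrough hx⟩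

theorem finite_nonemptyFaces_polyhedron : (nonemptyFaces (polyhedron l b)).Finite := by
  rw [nonemptyFaces_polyhedron]
  have : faceThrough l b '' polyhedron l b ⊆
      (fun s : Set J => {y ∈ polyhedron l b | s ⊆ activeSet l b y}) '' Set.univ := by
    rintro _ ⟨x, _, rfl⟩
    exact ⟨activeSet l b x, trivial, rfl⟩
  exact (Set.finite_univ.image _).subset this

end Polytope

/-! ### Tokens and the transfer operator -/

open Polynomial

/-- The combinatorial position of a coordinate of a point of the cube relative to the preceding
coordinate: equal to `0` (`bot`), equal to `1` (`top`), strictly between and different from the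
preceding coordinate (`fresh`), or strictly between and equal to it (`join`). -/
inductive Token : Type
  | bot
  | top
  | fresh
  | join
  deriving DecidableEq

namespace Token

instance : Fintype Token := ⟨{bot, top, fresh, join}, fun t => by cases t <;> decide⟩

/-- The level of a coordinate: `0` for the value `0`, `2` for the value `1`, and `1` for all values
strictly between. -/
def rank : Token → ℕ
  | bot => 0
  | top => 2
  | fresh => 1
  | join => 1

/-- `Step c s t` says that the token `t` may follow the token `s` across the letter `c`: the levels
are ordered as `c` prescribes, and only an interior value can be joined. Two interior values are
always compatible, since the tokens do not record their order. -/
def Step (c : XYLetter) (s t : Token) : Prop :=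
  (match c with
    | .x => s.rank ≤ t.rank
    | .y => t.rank ≤ s.rank) ∧ (t = join → s.rank = 1)

instance (c : XYLetter) (s t : Token) : Decidable (Step c s t) := by
  cases c <;> unfold Step <;> infer_instance

/-- The weight of a token in the generating function of the faces by dimension: each `fresh` token
contributes one dimension. -/
noncomputable def weight (t : Token) : ℕ[X] := if t = fresh then X else 1

/-- The exchange of the values `0` and `1`. -/
def flip : Token → Token
  | bot => top
  | top => bot
  | fresh => fresh
  | join => join

theorem sum_univ {M : Type*} [AddCommMonoid M] (f : Token → M) :
    ∑ t, f t = f bot + (f top + (f fresh + f join)) := by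
  change ∑ t ∈ {bot, top, fresh, join}, f t = _
  simp

end Token

open Token

/-- Weighted sum of `g` over all tokens that may follow a given token across the letter `c`. -/
noncomputable def transfer (c : XYLetter) (g : Token → ℕ[X]) (s : Token) : ℕ[X] :=
  ∑ t, if Step c s t then weight t * g t else 0

/-- Weighted sum over all token sequences that may follow a given token along the word `w`, with
`g` evaluated at the last token. -/
noncomputable def transferWord (g : Token → ℕ[X]) (w : XYWord) : Token → ℕ[X] :=
  w.foldr transfer g

@[simp] theorem transferWord_cons (g : Token → ℕ[X]) (c : XYLetter) (w : XYWord) :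
    transferWord g (c :: w) = transfer c (transferWord g w) := rfl

theorem transferWord_append (g : Token → ℕ[X]) (u w : XYWord) :
    transferWord g (u ++ w) = transferWord (transferWord g w) u := List.foldr_append

theorem transfer_x_bot (g : Token → ℕ[X]) :
    transfer .x g bot = g bot + g top + X * g fresh := by
  simp [transfer, sum_univ, Step, rank, weight, add_assoc]

theorem transfer_fresh (c : XYLetter) (g : Token → ℕ[X]) :
    transfer c g fresh = transfer c g join := rfl

theorem transfer_add_mul (c : XYLetter) (g h : Token → ℕ[X]) (k : ℕ[X]) (s : Token) :
    transfer c (fun t => g t + k * h t) s = transfer c g s + k * transfer c h s := by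
  simp only [transfer, Finset.mul_sum, ← Finset.sum_add_distrib]
  refine Finset.sum_congr rfl fun t _ => ?_
  split_ifs <;> ring

theorem transferWord_add_mul (g h : Token → ℕ[X]) (k : ℕ[X]) (w : XYWord) (s : Token) :
    transferWord (fun t => g t + k * h t) w s = transferWord g w s + k * transferWord h w s := by
  induction w generalizing s with
  | nil => rfl
  | cons c w ih =>
    rw [transferWord_cons, funext ih, transfer_add_mul]
    rfl

theorem transfer_swap (c : XYLetter) (g : Token → ℕ[X]) (s : Token) :
    transfer c.swap g s = transfer c (fun t => g t.flip) s.flip := by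
  cases c <;> cases s <;>
    simp [transfer, sum_univ, Step, rank, weight, XYLetter.swap, Token.flip] <;> ring

/-- Exchanging the letters amounts to exchanging the values `0` and `1`. -/
theorem transferWord_bar (w : XYWord) (s : Token) :
    transferWord (fun _ => 1) w.bar s = transferWord (fun _ => 1) w s.flip := by
  induction w generalizing s with
  | nil => rfl
  | cons c w ih =>
    change transfer c.swap (transferWord (fun _ => 1) (XYWord.bar w)) s = _
    rw [funext ih, transfer_swap, transferWord_cons]
    congr 1
    funext t
    cases t <;> rfl

/-- Replacing `yx` by `yy` and flipping what follows costs the product of the completions on the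
right that start at `0` or at a new interior value, and of the indicator of not ending at `1` on
the left. -/
theorem transfer_y_x_eq (h : Token → ℕ[X]) (hj : h join = h fresh) (s : Token) :
    transfer .y (transfer .x h) s =
      transfer .y (transfer .y fun t => h t.flip) s +
        (h bot + X * h fresh) * (if s = top then 0 else 1) := by
  cases s <;> simp [transfer, sum_univ, Step, rank, weight, Token.flip, hj] <;> ring

theorem transferWord_one_join (w : XYWord) :
    transferWord (fun _ => 1) w join = transferWord (fun _ => 1) w fresh := by
  cases w <;> rfl

/-- The generating function of the faces splits off the product of a factor depending on `v` and a
factor depending on `u` when `yx` is replaced by `yy`. -/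
theorem transferWord_yx_eq (u v : XYWord) (s : Token) :
    transferWord (fun _ => 1) (u ++ [XYLetter.y, XYLetter.x] ++ v) s =
      transferWord (fun _ => 1) (u ++ [XYLetter.y, XYLetter.y] ++ v.bar) s +
        (transferWord (fun _ => 1) v bot + X * transferWord (fun _ => 1) v fresh) *
          transferWord (fun t => if t = top then 0 else 1) u s := by
  rw [List.append_assoc, List.append_assoc, transferWord_append _ u, transferWord_append _ u,
    ← transferWord_add_mul]
  congr 1
  funext t
  simp only [List.cons_append, List.nil_append, transferWord_cons]
  rw [transfer_y_x_eq _ (transferWord_one_join v), funext (transferWord_bar v)]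

theorem coeff_transferWord_bot_pos {g : Token → ℕ[X]} (hg : 0 < (g bot).coeff 0) (w : XYWord) :
    0 < (transferWord g w bot).coeff 0 := by
  induction w with
  | nil => exact hg
  | cons c w ih =>
    rw [transferWord_cons]
    cases c <;> simp [transfer, sum_univ, Step, rank, weight] <;> omega

/-- The sequences consisting of interior values alone contribute `(1 + t) ^ |w|`. -/
theorem coeff_transferWord_fresh_pos {g : Token → ℕ[X]} (hf : 0 < (g fresh).coeff 0)
    (hj : 0 < (g join).coeff 0) (w : XYWord) (i : ℕ) (hi : i ≤ w.length) :
    0 < (transferWord g w fresh).coeff i ∧ 0 < (transferWord g w join).coeff i := by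
  induction w generalizing i with
  | nil =>
    obtain rfl : i = 0 := by simpa using hi
    exact ⟨hf, hj⟩
  | cons c w ih =>
    rw [transferWord_cons, transfer_fresh, and_self]
    obtain _ | i := i
    · have := (ih 0 (Nat.zero_le _)).2
      cases c <;> simp [transfer, sum_univ, Step, rank, weight] <;> omega
    · have := (ih i (by simpa using hi)).1
      cases c <;> simp [transfer, sum_univ, Step, rank, weight, coeff_X_mul] <;> omega

theorem coeff_bot_add_fresh_pos {g : Token → ℕ[X]} (hg : ∀ t ≠ top, 0 < (g t).coeff 0)
    (w : XYWord) (i : ℕ) (hi : i ≤ w.length + 1) :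
    0 < (transferWord g w bot + X * transferWord g w fresh).coeff i := by
  obtain _ | i := i
  · have := coeff_transferWord_bot_pos (hg bot (by decide)) w
    simpa using this
  · have := (coeff_transferWord_fresh_pos (hg fresh (by decide)) (hg join (by decide)) w i
      (by omega)).1
    rw [coeff_add, coeff_X_mul]
    omega

theorem coeff_mul_pos_of_coeff_pos {f g : ℕ[X]} {a b i : ℕ} (hf : ∀ j ≤ a, 0 < f.coeff j)
    (hg : ∀ j ≤ b, 0 < g.coeff j) (hi : i ≤ a + b) : 0 < (f * g).coeff i := by
  rw [coeff_mul]
  have hmem : (min i a, i - min i a) ∈ Finset.HasAntidiagonal.antidiagonal i := by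
    rw [Finset.HasAntidiagonal.mem_antidiagonal]
    omega
  exact (Nat.mul_pos (hf _ (min_le_right _ _)) (hg _ (by omega))).trans_le
    (Finset.single_le_sum (f := fun p : ℕ × ℕ => f.coeff p.1 * g.coeff p.2)
      (fun _ _ => Nat.zero_le _) hmem)

/-- The leading letter `x` after a fictitious coordinate `0` puts no condition on the first
coordinate and makes the token `join` unavailable there. -/
theorem coeff_transferWord_yy_lt (u v : XYWord) (i : ℕ) (hi : i ≤ u.length + v.length + 2) :
    (transferWord (fun _ => 1)
        (XYLetter.x :: (u ++ [XYLetter.y, XYLetter.y] ++ v.bar)) bot).coeff i <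
      (transferWord (fun _ => 1)
        (XYLetter.x :: (u ++ [XYLetter.y, XYLetter.x] ++ v)) bot).coeff i := by
  have h := transferWord_yx_eq (XYLetter.x :: u) v bot
  simp only [List.cons_append] at h
  rw [h, coeff_add]
  refine Nat.lt_add_of_pos_right (coeff_mul_pos_of_coeff_pos (a := v.length + 1)
    (b := u.length + 1) (coeff_bot_add_fresh_pos (by simp) v) (fun j hj => ?_) (by omega))
  have := coeff_bot_add_fresh_pos (g := fun t => if t = top then 0 else 1)
    (fun t ht => by simp [ht]) u j hj
  rw [transferWord_cons, transfer_x_bot, add_right_comm, coeff_add]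
  omega

/-! ### Counting token sequences -/

/-- `ValidSeq w s τ`: the tokens `τ` may follow the token `s` along the word `w`. -/
def ValidSeq (w : XYWord) (s : Token) (τ : Fin w.length → Token) : Prop :=
  ∀ i : Fin w.length, Step (w.get i) ((Fin.cons s τ : Fin (w.length + 1) → Token) i.castSucc) (τ i)

instance (w : XYWord) (s : Token) (τ : Fin w.length → Token) : Decidable (ValidSeq w s τ) := by
  unfold ValidSeq
  infer_instance

theorem validSeq_cons (c : XYLetter) (w : XYWord) (s t : Token) (τ : Fin w.length → Token) :
    ValidSeq (c :: w) s (Fin.cons t τ : Fin (w.length + 1) → Token) ↔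
      Step c s t ∧ ValidSeq w t τ := by
  unfold ValidSeq
  exact Fin.forall_fin_succ

/-- Iterating the transfer operator sums the weights of all compatible token sequences. -/
theorem transferWord_one_eq_sum (w : XYWord) (s : Token) :
    transferWord (fun _ => 1) w s =
      ∑ τ : Fin w.length → Token, if ValidSeq w s τ then ∏ i, weight (τ i) else 0 := by
  induction w generalizing s with
  | nil =>
    have : Unique (Fin ([] : XYWord).length → Token) := inferInstanceAs (Unique (Fin 0 → Token))
    have hv : ∀ τ, ValidSeq [] s τ := fun τ (i : Fin 0) => i.elim0
    rw [Fintype.sum_unique, if_pos (hv _)]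
    rfl
  | cons c w ih =>
    rw [transferWord_cons, transfer]
    have : ∑ τ : Fin (c :: w).length → Token,
        (if ValidSeq (c :: w) s τ then ∏ i, weight (τ i) else 0) =
        ∑ q : Token × (Fin w.length → Token),
          if ValidSeq (c :: w) s (Fin.cons q.1 q.2 : Fin (w.length + 1) → Token) then
            ∏ i, weight ((Fin.cons q.1 q.2 : Fin (w.length + 1) → Token) i) else 0 :=
      ((Fin.consEquiv fun _ : Fin (w.length + 1) => Token).sum_comp _).symm
    rw [this, Fintype.sum_prod_type]
    refine Finset.sum_congr rfl fun t _ => ?_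
    simp only [validSeq_cons, Fin.prod_univ_succ, Fin.cons_zero, Fin.cons_succ]
    rw [ih, Finset.mul_sum]
    split_ifs with h
    · refine Finset.sum_congr rfl fun τ _ => ?_
      simp [h]
    · simp [h]

/-- The number of `fresh` tokens in a sequence. -/
def freshCount {n : ℕ} (τ : Fin n → Token) : ℕ := Fintype.card {i // τ i = fresh}

theorem prod_weight {n : ℕ} (τ : Fin n → Token) : ∏ i, weight (τ i) = X ^ freshCount τ := by
  simp only [weight, Finset.prod_ite, Finset.prod_const, one_pow, mul_one, freshCount,
    Fintype.card_subtype]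

theorem coeff_transferWord_one (w : XYWord) (s : Token) (i : ℕ) :
    (transferWord (fun _ => 1) w s).coeff i =
      {τ : Fin w.length → Token | ValidSeq w s τ ∧ freshCount τ = i}.ncard := by
  classical
  rw [transferWord_one_eq_sum, finsetSum_coeff, Set.ncard_eq_toFinset_card', Set.toFinset_ofPred,
    Finset.card_filter]
  refine Finset.sum_congr rfl fun τ _ => ?_
  rw [prod_weight, ite_and]
  split_ifs <;> simp_all [coeff_X_pow, eq_comm]

/-! ### Tokens of a point -/

/-- The token of a coordinate with value `y` that is preceded by the value `x`. -/
noncomputable def tokenOf (x y : ℝ) : Token :=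
  if y = 0 then bot else if y = 1 then top else if y = x then join else fresh

/-- The letter `c` allows the value `x` to be followed by `y`. -/
def LetterRel (c : XYLetter) (x y : ℝ) : Prop :=
  match c with
  | .x => x ≤ y
  | .y => y ≤ x

/-- The points of the cube that can follow a coordinate with value `x` along the word `w`. -/
def polytopeAfter (w : XYWord) (x : ℝ) : Set (Fin w.length → ℝ) :=
  {p | ∀ i : Fin w.length, p i ∈ Set.Icc (0 : ℝ) 1 ∧
    LetterRel (w.get i) ((Fin.cons x p : Fin (w.length + 1) → ℝ) i.castSucc) (p i)}

/-- The token sequence of a point whose first coordinate is preceded by the value `x`. -/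
noncomputable def tokens {n : ℕ} (x : ℝ) (p : Fin n → ℝ) (i : Fin n) : Token :=
  tokenOf ((Fin.cons x p : Fin (n + 1) → ℝ) i.castSucc) (p i)

/-- The token `s` has the level of the value `x`. -/
def RankMatches (s : Token) (x : ℝ) : Prop := (s = bot ↔ x = 0) ∧ (s = top ↔ x = 1)

theorem rankMatches_tokenOf (x y : ℝ) : RankMatches (tokenOf x y) y := by
  unfold RankMatches tokenOf
  split_ifs <;> simp_all

theorem RankMatches.rank_le_rank {s t : Token} {x y : ℝ} (hs : RankMatches s x)
    (ht : RankMatches t y) (hx : x ∈ Set.Icc (0 : ℝ) 1) (hy : y ∈ Set.Icc (0 : ℝ) 1)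
    (h : x ≤ y) : s.rank ≤ t.rank := by
  have h0 : t = bot → s = bot := fun h' => hs.1.2 (le_antisymm (ht.1.1 h' ▸ h) hx.1)
  have h1 : s = top → t = top := fun h' => ht.2.2 (le_antisymm hy.2 (hs.2.1 h' ▸ h))
  clear hs ht
  cases s <;> cases t <;> simp_all [rank]

theorem step_tokenOf {c : XYLetter} {s : Token} {x y : ℝ} (hs : RankMatches s x)
    (hx : x ∈ Set.Icc (0 : ℝ) 1) (hy : y ∈ Set.Icc (0 : ℝ) 1) (h : LetterRel c x y) :
    Step c s (tokenOf x y) := by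
  refine ⟨?_, fun ht => ?_⟩
  · cases c with
    | x => exact hs.rank_le_rank (rankMatches_tokenOf x y) hx hy h
    | y => exact (rankMatches_tokenOf x y).rank_le_rank hs hy hx h
  · unfold tokenOf at ht
    split_ifs at ht with h0 h1 hxy
    subst hxy
    cases s <;> simp_all [RankMatches, rank]

theorem exists_tokenOf_eq {c : XYLetter} {s t : Token} {x : ℝ} (hs : RankMatches s x)
    (hx : x ∈ Set.Icc (0 : ℝ) 1) (h : Step c s t) :
    ∃ y ∈ Set.Icc (0 : ℝ) 1, LetterRel c x y ∧ tokenOf x y = t := by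
  obtain ⟨hx0, hx1⟩ := hx
  cases t with
  | bot =>
    refine ⟨0, by simp, ?_, by simp [tokenOf]⟩
    cases c <;> cases s <;> simp_all [Step, rank, RankMatches, LetterRel]
  | top =>
    refine ⟨1, by simp, ?_, by simp [tokenOf]⟩
    cases c <;> cases s <;> simp_all [Step, rank, RankMatches, LetterRel]
  | join =>
    refine ⟨x, ⟨hx0, hx1⟩, ?_, ?_⟩
    · cases c <;> exact le_rfl
    · cases s <;> simp_all [Step, rank, RankMatches, tokenOf]
  | fresh =>
    cases c with
    | x =>
      have hlt : x < 1 := lt_of_le_of_ne hx1 fun h1 => by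
        cases s <;> simp_all [Step, rank, RankMatches]
      refine ⟨(x + 1) / 2, ⟨by linarith, by linarith⟩, ?_, ?_⟩
      · change x ≤ _
        linarith
      · rw [tokenOf, if_neg (by linarith), if_neg (by linarith), if_neg (by linarith)]
    | y =>
      have hlt : 0 < x := lt_of_le_of_ne hx0 fun h1 => by
        cases s <;> simp_all [Step, rank, RankMatches]
      refine ⟨x / 2, ⟨by linarith, by linarith⟩, ?_, ?_⟩
      · change _ ≤ x
        linarith
      · rw [tokenOf, if_neg (by linarith), if_neg (by linarith), if_neg (by linarith)]

theorem validSeq_tokens {w : XYWord} {s : Token} {x : ℝ} (hs : RankMatches s x)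
    (hx : x ∈ Set.Icc (0 : ℝ) 1) {p : Fin w.length → ℝ} (hp : p ∈ polytopeAfter w x) :
    ValidSeq w s (tokens x p) := by
  intro i
  refine step_tokenOf ?_ ?_ (hp i).1 (hp i).2
  · refine Fin.cases ?_ (fun j => ?_) i.castSucc
    · simpa using hs
    · exact rankMatches_tokenOf _ _
  · refine Fin.cases ?_ (fun j => ?_) i.castSucc
    · simpa using hx
    · simpa using (hp j).1

/-- Every compatible token sequence is realized: a new interior value can be chosen halfway between
the preceding value and the end of `[0, 1]` that the letter points to. -/
theorem exists_tokens_eq (w : XYWord) {s : Token} {x : ℝ} (hs : RankMatches s x)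
    (hx : x ∈ Set.Icc (0 : ℝ) 1) {τ : Fin w.length → Token} (h : ValidSeq w s τ) :
    ∃ p ∈ polytopeAfter w x, tokens x p = τ := by
  induction w generalizing s x with
  | nil => exact ⟨fun i => i.elim0, fun i => i.elim0, funext fun i => i.elim0⟩
  | cons c w ih =>
    obtain ⟨t, τ, rfl⟩ : ∃ t τ', τ = (Fin.cons t τ' : Fin (w.length + 1) → Token) :=
      ⟨_, _, (Fin.cons_self_tail (α := fun _ => Token) τ).symm⟩
    rw [validSeq_cons] at h
    obtain ⟨y, hy, hrel, ht⟩ := exists_tokenOf_eq hs hx h.1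
    obtain ⟨p, hp, hτ⟩ := ih (ht ▸ rankMatches_tokenOf x y) hy h.2
    refine ⟨(Fin.cons y p : Fin (w.length + 1) → ℝ), ?_, ?_⟩
    · exact Fin.forall_fin_succ.2 ⟨⟨hy, hrel⟩, hp⟩
    · refine funext (Fin.forall_fin_succ.2 ⟨ht, fun i => ?_⟩)
      exact congrFun hτ i

theorem tokens_image_polytopeAfter (w : XYWord) :
    tokens 0 '' polytopeAfter w 0 = {τ | ValidSeq w bot τ} := by
  have h0 : RankMatches bot 0 := by simp [RankMatches]
  ext τ
  constructor
  · rintro ⟨p, hp, rfl⟩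
    exact validSeq_tokens h0 (by simp) hp
  · exact fun h => exists_tokens_eq w h0 (by simp) h

/-! ### Dimension of the space of directions with given tokens -/

/-- The directions that keep a point with tokens `τ` in the relative interior of its face. -/
def tokenSpace {n : ℕ} (τ : Fin n → Token) : Submodule ℝ (Fin n → ℝ) where
  carrier := {v | ∀ i, (τ i = bot ∨ τ i = top → v i = 0) ∧
    (τ i = join → v i = (Fin.cons 0 v : Fin (n + 1) → ℝ) i.castSucc)}
  zero_mem' i := ⟨fun _ => rfl, fun _ => by
    refine Fin.cases ?_ (fun j => ?_) i.castSucc <;> simp⟩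
  add_mem' {a b} ha hb i := ⟨fun h => by simp [(ha i).1 h, (hb i).1 h], fun h => by
    rw [Pi.add_apply, (ha i).2 h, (hb i).2 h]
    refine Fin.cases ?_ (fun j => ?_) i.castSucc <;> simp⟩
  smul_mem' r a ha i := ⟨fun h => by simp [(ha i).1 h], fun h => by
    rw [Pi.smul_apply, (ha i).2 h]
    refine Fin.cases ?_ (fun j => ?_) i.castSucc <;> simp⟩

theorem mem_tokenSpace {n : ℕ} {τ : Fin n → Token} {v : Fin n → ℝ} :
    v ∈ tokenSpace τ ↔ ∀ i, (τ i = bot ∨ τ i = top → v i = 0) ∧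
      (τ i = join → v i = (Fin.cons 0 v : Fin (n + 1) → ℝ) i.castSucc) := Iff.rfl

theorem exists_extension_of_fresh {n : ℕ} (τ : Fin n → Token) (f : Fin n → ℝ) (x : ℝ) :
    ∃ v : Fin n → ℝ, ∀ i, v i = match τ i with
      | bot => 0
      | top => 0
      | fresh => f i
      | join => (Fin.cons x v : Fin (n + 1) → ℝ) i.castSucc := by
  induction n generalizing x with
  | zero => exact ⟨fun i => i.elim0, fun i => i.elim0⟩
  | succ n ih =>
    obtain ⟨v, hv⟩ := ih (fun i => τ i.succ) (fun i => f i.succ)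
      (match τ 0 with
        | bot => 0
        | top => 0
        | fresh => f 0
        | join => x)
    exact ⟨Fin.cons _ v, Fin.forall_fin_succ.2 ⟨rfl, hv⟩⟩

theorem finrank_tokenSpace {n : ℕ} (τ : Fin n → Token) :
    Module.finrank ℝ (tokenSpace τ) = freshCount τ := by
  -- Restriction to the `fresh` coordinates is an isomorphism.
  let φ : tokenSpace τ →ₗ[ℝ] ({i // τ i = fresh} → ℝ) :=
    { toFun := fun v i => v.1 i.1
      map_add' := fun _ _ => rfl
      map_smul' := fun _ _ => rfl }
  have hinj : Function.Injective φ := by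
    rw [injective_iff_map_eq_zero]
    rintro ⟨v, hv⟩ h
    have h' : ∀ i, τ i = fresh → v i = 0 := fun i hi => congrFun h ⟨i, hi⟩
    have key : ∀ i : Fin (n + 1), (Fin.cons 0 v : Fin (n + 1) → ℝ) i = 0 := by
      refine Fin.induction rfl fun i hi => ?_
      rw [Fin.cons_succ]
      cases ht : τ i with
      | bot => exact (hv i).1 (Or.inl ht)
      | top => exact (hv i).1 (Or.inr ht)
      | fresh => exact h' i ht
      | join => exact ((hv i).2 ht).trans hi
    exact Subtype.ext (funext fun i => by simpa using key i.succ)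
  have hsurj : Function.Surjective φ := by
    intro f
    obtain ⟨f', hf'⟩ : ∃ f' : Fin n → ℝ, ∀ i h, f' i = f ⟨i, h⟩ :=
      ⟨fun i => if h : τ i = fresh then f ⟨i, h⟩ else 0, fun i h => dif_pos h⟩
    obtain ⟨v, hv⟩ := exists_extension_of_fresh τ f' 0
    refine ⟨⟨v, fun i => ⟨?_, fun h => ?_⟩⟩, ?_⟩
    · rintro (h | h) <;> rw [hv i, h]
    · rw [hv i, h]
    · ext ⟨i, hi⟩
      change v i = _
      rw [hv i, hi]
      exact hf' i hi
  rw [(LinearEquiv.ofBijective φ ⟨hinj, hsurj⟩).finrank_eq, Module.finrank_fintype_fun_eq_card]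
  rfl

/-! ### The face structure of descent polytopes -/

/-- The `i`-th coordinate function on `ℝⁿ`. -/
noncomputable abbrev coord {n : ℕ} (i : Fin n) : StrongDual ℝ (Fin n → ℝ) :=
  ContinuousLinearMap.proj (φ := fun _ => ℝ) i

/-- The linear forms of the inequalities `-pᵢ ≤ 0`, `pᵢ ≤ 1` and `± (pᵢ - pᵢ₊₁) ≤ 0` that define
the descent polytope of `w`. -/
noncomputable def descentForm (w : XYWord) :
    Fin (w.length + 1) ⊕ Fin (w.length + 1) ⊕ Fin w.length →
      StrongDual ℝ (Fin (w.length + 1) → ℝ)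
  | .inl i => -coord i
  | .inr (.inl i) => coord i
  | .inr (.inr i) => match w.get i with
    | .x => coord i.castSucc - coord i.succ
    | .y => coord i.succ - coord i.castSucc

/-- The right-hand sides of the inequalities that define the descent polytope of `w`. -/
def descentBound (w : XYWord) : Fin (w.length + 1) ⊕ Fin (w.length + 1) ⊕ Fin w.length → ℝ
  | .inl _ => 0
  | .inr (.inl _) => 1
  | .inr (.inr _) => 0

theorem descentPolytope_eq_polyhedron (w : XYWord) :
    descentPolytope w = polyhedron (descentForm w) (descentBound w) := by
  ext p
  simp only [descentPolytope, polyhedron, Set.mem_ofPred_eq, Sum.forall, forall_and, and_assoc]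
  refine and_congr (forall_congr' fun i => by simp [descentForm, descentBound])
    (and_congr (forall_congr' fun i => by simp [descentForm, descentBound]) ?_)
  rw [← forall_and]
  refine forall_congr' fun i => ?_
  simp only [descentForm, descentBound]
  cases w.get i <;> simp

theorem descentPolytope_eq_polytopeAfter (w : XYWord) :
    descentPolytope w = polytopeAfter (XYLetter.x :: w) 0 := by
  ext p
  have hrel : ∀ i : Fin w.length, LetterRel (w.get i) (p i.castSucc) (p i.succ) ↔
      (w.get i = XYLetter.x → p i.castSucc ≤ p i.succ) ∧
        (w.get i = XYLetter.y → p i.castSucc ≥ p i.succ) := fun i => by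
    cases w.get i <;> simp [LetterRel]
  constructor
  · rintro ⟨h, h'⟩
    exact Fin.forall_fin_succ.2 ⟨⟨h 0, (h 0).1⟩, fun i => ⟨h i.succ, (hrel i).2 (h' i)⟩⟩
  · intro h
    exact ⟨fun i => (h i).1, fun i => (hrel i).1 (h i.succ).2⟩

theorem inl_mem_activeSet {w : XYWord} {p : Fin (w.length + 1) → ℝ} {i : Fin (w.length + 1)} :
    .inl i ∈ activeSet (descentForm w) (descentBound w) p ↔ p i = 0 := by
  simp [activeSet, descentForm, descentBound]

theorem inr_inl_mem_activeSet {w : XYWord} {p : Fin (w.length + 1) → ℝ}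
    {i : Fin (w.length + 1)} :
    .inr (.inl i) ∈ activeSet (descentForm w) (descentBound w) p ↔ p i = 1 := by
  simp [activeSet, descentForm, descentBound]

theorem descentForm_inr_inr_eq_zero {w : XYWord} {p : Fin (w.length + 1) → ℝ}
    {i : Fin w.length} : descentForm w (.inr (.inr i)) p = 0 ↔ p i.succ = p i.castSucc := by
  simp only [descentForm]
  cases w.get i <;> simp [sub_eq_zero, eq_comm]

theorem inr_inr_mem_activeSet {w : XYWord} {p : Fin (w.length + 1) → ℝ} {i : Fin w.length} :
    .inr (.inr i) ∈ activeSet (descentForm w) (descentBound w) p ↔ p i.succ = p i.castSucc :=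
  descentForm_inr_inr_eq_zero

theorem tokens_zero {n : ℕ} (x : ℝ) (p : Fin (n + 1) → ℝ) : tokens x p 0 = tokenOf x (p 0) := rfl

theorem tokens_succ {n : ℕ} (x : ℝ) (p : Fin (n + 1) → ℝ) (i : Fin n) :
    tokens x p i.succ = tokenOf (p i.castSucc) (p i.succ) := rfl

theorem tokens_eq_bot_iff {n : ℕ} {x : ℝ} {p : Fin n → ℝ} {i : Fin n} :
    tokens x p i = bot ↔ p i = 0 := (rankMatches_tokenOf _ _).1

theorem tokens_eq_top_iff {n : ℕ} {x : ℝ} {p : Fin n → ℝ} {i : Fin n} :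
    tokens x p i = top ↔ p i = 1 := (rankMatches_tokenOf _ _).2

theorem tokenOf_eq_join_iff {x y : ℝ} : tokenOf x y = join ↔ y ≠ 0 ∧ y ≠ 1 ∧ y = x := by
  unfold tokenOf
  split_ifs <;> simp_all

theorem tokens_zero_ne_join {n : ℕ} (p : Fin (n + 1) → ℝ) : tokens 0 p 0 ≠ join := by
  rw [tokens_zero, Ne, tokenOf_eq_join_iff]
  exact fun h => h.1 h.2.2

theorem tokenOf_congr {x y x' y' : ℝ} (h0 : y = 0 ↔ y' = 0) (h1 : y = 1 ↔ y' = 1)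
    (h : y = x ↔ y' = x') : tokenOf x y = tokenOf x' y' := by
  simp only [tokenOf, h0, h1, h]

/-- The tokens of a point record exactly which inequalities are tight. -/
theorem activeSet_eq_iff_tokens_eq {w : XYWord} {p q : Fin (w.length + 1) → ℝ} :
    activeSet (descentForm w) (descentBound w) p = activeSet (descentForm w) (descentBound w) q ↔
      tokens 0 p = tokens 0 q := by
  simp only [Set.ext_iff, Sum.forall, inl_mem_activeSet, inr_inl_mem_activeSet,
    inr_inr_mem_activeSet]
  constructor
  · rintro ⟨h0, h1, h⟩
    exact funext (Fin.forall_fin_succ.2 ⟨tokenOf_congr (h0 0) (h1 0) (h0 0),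
      fun i => tokenOf_congr (h0 _) (h1 _) (h i)⟩)
  · intro h
    have h0 : ∀ i, p i = 0 ↔ q i = 0 := fun i => by
      rw [← tokens_eq_bot_iff (x := 0), h, tokens_eq_bot_iff]
    have h1 : ∀ i, p i = 1 ↔ q i = 1 := fun i => by
      rw [← tokens_eq_top_iff (x := 0), h, tokens_eq_top_iff]
    refine ⟨h0, h1, fun i => ?_⟩
    have hj : tokens 0 p i.succ = join ↔ tokens 0 q i.succ = join := by rw [h]
    simp only [tokens_succ, tokenOf_eq_join_iff] at hj
    by_cases hp0 : p i.succ = 0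
    · rw [hp0, (h0 _).1 hp0, eq_comm, h0, eq_comm]
    by_cases hp1 : p i.succ = 1
    · rw [hp1, (h1 _).1 hp1, eq_comm, h1, eq_comm]
    · simpa [← h0, ← h1, hp0, hp1] using hj

theorem forall_activeSet_eq_zero_iff {w : XYWord} {p v : Fin (w.length + 1) → ℝ} :
    (∀ j ∈ activeSet (descentForm w) (descentBound w) p, descentForm w j v = 0) ↔
      v ∈ tokenSpace (tokens 0 p) := by
  simp only [Sum.forall, inl_mem_activeSet, inr_inl_mem_activeSet, inr_inr_mem_activeSet,
    descentForm_inr_inr_eq_zero, mem_tokenSpace, tokens_eq_bot_iff, tokens_eq_top_iff]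
  have hneg : ∀ i, descentForm w (.inl i) v = 0 ↔ v i = 0 := fun i => by simp [descentForm]
  have hpos : ∀ i, descentForm w (.inr (.inl i)) v = 0 ↔ v i = 0 := fun i => by simp [descentForm]
  simp only [hneg, hpos]
  constructor
  · rintro ⟨h0, h1, h⟩
    refine fun i => ⟨fun hi => hi.elim (h0 i) (h1 i), ?_⟩
    refine Fin.cases (fun hi => absurd hi (tokens_zero_ne_join p)) (fun j hj => ?_) i
    rw [tokens_succ, tokenOf_eq_join_iff] at hj
    exact h j hj.2.2
  · intro h
    refine ⟨fun i hi => (h i).1 (Or.inl hi), fun i hi => (h i).1 (Or.inr hi), fun i hi => ?_⟩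
    by_cases hp0 : p i.succ = 0
    · rw [(h _).1 (Or.inl hp0), (h _).1 (Or.inl (hi ▸ hp0))]
    by_cases hp1 : p i.succ = 1
    · rw [(h _).1 (Or.inr hp1), (h _).1 (Or.inr (hi ▸ hp1))]
    · exact (h i.succ).2 (tokenOf_eq_join_iff.2 ⟨hp0, hp1, hi⟩)

theorem affDim_faceThrough {w : XYWord} {p : Fin (w.length + 1) → ℝ}
    (hp : p ∈ polyhedron (descentForm w) (descentBound w)) :
    affDim (faceThrough (descentForm w) (descentBound w) p) = freshCount (tokens 0 p) := by
  rw [affDim, ← finrank_tokenSpace]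
  have : vectorSpan ℝ (faceThrough (descentForm w) (descentBound w) p) =
      tokenSpace (tokens 0 p) := by
    ext v
    rw [mem_vectorSpan_faceThrough hp, forall_activeSet_eq_zero_iff]
  rw [this]

theorem ncard_image_eq_ncard_image {α β γ : Type*} {s : Set α} {f : α → β} {g : α → γ}
    (h : ∀ x ∈ s, ∀ y ∈ s, f x = f y ↔ g x = g y) : (f '' s).ncard = (g '' s).ncard := by
  refine Set.ncard_congr (fun b hb => g hb.choose) (fun b hb => ⟨_, hb.choose_spec.1, rfl⟩)
    (fun b c hb hc hbc => ?_) ?_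
  · rw [← hb.choose_spec.2, ← hc.choose_spec.2]
    exact (h _ hb.choose_spec.1 _ hc.choose_spec.1).2 hbc
  · rintro _ ⟨x, hx, rfl⟩
    have hb : f x ∈ f '' s := ⟨x, hx, rfl⟩
    exact ⟨f x, hb, (h _ hb.choose_spec.1 _ hx).1 hb.choose_spec.2⟩

/-- Faces are counted by the token sequences along the word, where the first coordinate is preceded
by a fictitious coordinate `0` and a letter `x`. -/
theorem fNumber_descentPolytope (w : XYWord) (i : ℕ) :
    fNumber (descentPolytope w) i =
      (transferWord (fun _ => 1) (XYLetter.x :: w) bot).coeff i := by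
  set P := descentPolytope w with hP
  have hPP := descentPolytope_eq_polyhedron w
  have hfaces : {F ∈ nonemptyFaces P | affDim F = i} =
      faceThrough (descentForm w) (descentBound w) '' {p ∈ P | freshCount (tokens 0 p) = i} := by
    rw [hP, hPP, nonemptyFaces_polyhedron]
    ext F
    constructor
    · rintro ⟨⟨p, hp, rfl⟩, hi⟩
      exact ⟨p, ⟨hp, affDim_faceThrough hp ▸ hi⟩, rfl⟩
    · rintro ⟨p, ⟨hp, hi⟩, rfl⟩
      exact ⟨⟨p, hp, rfl⟩, (affDim_faceThrough hp).trans hi⟩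
  have htokens : {τ | ValidSeq (XYLetter.x :: w) bot τ ∧ freshCount τ = i} =
      tokens 0 '' {p ∈ P | freshCount (tokens 0 p) = i} := by
    have himg := tokens_image_polytopeAfter (XYLetter.x :: w)
    rw [← descentPolytope_eq_polytopeAfter, ← hP] at himg
    ext τ
    constructor
    · rintro ⟨hτ, hi⟩
      obtain ⟨p, hp, rfl⟩ := himg.ge hτ
      exact ⟨p, ⟨hp, hi⟩, rfl⟩
    · rintro ⟨p, ⟨hp, hi⟩, rfl⟩
      exact ⟨himg.le ⟨p, hp, rfl⟩, hi⟩
  rw [fNumber, coeff_transferWord_one, hfaces, htokens]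
  refine ncard_image_eq_ncard_image fun p hp q hq => ?_
  rw [faceThrough_eq_iff (hPP ▸ hp.1) (hPP ▸ hq.1), activeSet_eq_iff_tokens_eq]

theorem finite_nonemptyFaces_descentPolytope (w : XYWord) :
    (nonemptyFaces (descentPolytope w)).Finite := by
  rw [descentPolytope_eq_polyhedron]
  exact finite_nonemptyFaces_polyhedron _ _

theorem coeff_descentFPolynomial (w : XYWord) (i : ℕ) (hi : i ≤ w.length + 1) :
    (descentFPolynomial w).coeff i = fNumber (descentPolytope w) i := by
  have : i < w.length + 1 + 1 := by omega
  simp only [descentFPolynomial, fPolynomial, Polynomial.finsetSum_coeff,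
    Polynomial.coeff_C_mul, Polynomial.coeff_X_pow, mul_ite, mul_one, mul_zero,
    Finset.sum_ite_eq, Finset.mem_range, this, if_true]

theorem theorem2p4 (n : ℕ) (u v : XYWord) (hn : u.length + v.length + 3 = n) :
    (nonemptyFaces (descentPolytope (u ++ [XYLetter.y, XYLetter.x] ++ v))).Finite ∧
    (nonemptyFaces (descentPolytope (u ++ [XYLetter.y, XYLetter.y] ++ v.bar))).Finite ∧
    (∀ i : ℕ, i ≤ n - 1 →
      0 < (descentFPolynomial (u ++ [XYLetter.y, XYLetter.x] ++ v) -
            descentFPolynomial (u ++ [XYLetter.y, XYLetter.y] ++ v.bar)).coeff i) ∧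
    (∀ i : ℕ, i ≤ n - 1 →
      fNumber (descentPolytope (u ++ [XYLetter.y, XYLetter.y] ++ v.bar)) i <
        fNumber (descentPolytope (u ++ [XYLetter.y, XYLetter.x] ++ v)) i) := by
  have key : ∀ i : ℕ, i ≤ n - 1 →
      fNumber (descentPolytope (u ++ [XYLetter.y, XYLetter.y] ++ v.bar)) i <
        fNumber (descentPolytope (u ++ [XYLetter.y, XYLetter.x] ++ v)) i := fun i hi => by
    rw [fNumber_descentPolytope, fNumber_descentPolytope]
    exact coeff_transferWord_yy_lt u v i (by omega)
  refine ⟨finite_nonemptyFaces_descentPolytope _, finite_nonemptyFaces_descentPolytope _,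
    fun i hi => ?_, key⟩
  rw [Polynomial.coeff_sub, coeff_descentFPolynomial _ _ (by simp; omega),
    coeff_descentFPolynomial _ _ (by simp [XYWord.bar]; omega), sub_pos]
  exact_mod_cast key i hi
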